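/- Let $\Gamma$ be a directed graph (multiple edges and self-loops allowed) with vertices $v_1,\dots,v_{n+1}$, $v_\star:=v_{n+1}$, and edges numbered $1,\dots,|E_\Gamma|$. Put $L=|E_\Gamma|-n$ and assume that $L$ is even. Let $\mathbb I$ be the $|E_\Gamma|\times n$ reduced incidence matrix ($-1$ where an edge starts, $+1$ where it ends, column of $v_\star$ omitted, zero row for a self-loop). For $a\in(0,\infty)^{E_\Gamma}$ let $$\mathbb M=\begin{pmatrix}\operatorname{diag}(a)&\mathbb I\\-\mathbb I^T&0\end{pmatrix},\qquad \psi=\det\mathbb M,\qquad \psi^{e,f}=\det \mathbb M(e,f),$$ where $\mathbb M(e,f)$ is $\mathbb M$ with the row of the edge $e$ and the column of the edge $f$ removed. With positions $x_1,\dots,x_n\in\mathbb R$ of $v_1,\dots,v_n$, with $x_{v_\star}=0$, and with $s_e=a_e^{-1/2}(x_e^+-x_e^-)$, where $x_e^-$ and $x_e^+$ are the positions of the start and the end of $e$, define the differential form in the $a_e$ $$\alpha_\Gamma=\int_{\mathbb R^{n}}\ \bigwedge_{e\in E_\Gamma}e^{-s_e^2}\,\mathrm ds_e ,$$ where the wedge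 factors are in increasing order and the integral is the fibre integral over $\mathrm dx_1\wedge\dots\wedge\mathrm dx_n$, with all $\mathrm da_e$ written to the left of the $\mathrm dx_v$. Then for every spanning tree $T$ of $\Gamma$ and all $a_e>0$: the integrand of $\alpha_\Gamma$ is integrable, $\psi>0$, and the coefficient of $\bigwedge_{e\notin T}\mathrm da_e$ (increasing order) in $\alpha_\Gamma$ is $$\Big[\bigwedge_{e\notin T}\mathrm da_e\Big]\alpha_\Gamma=\frac{\pi^{n/2}}{4^{L}\,\left(\frac L2\right)!\;\psi^{\frac{L+1}2}}\ \det\big(\mathbb I[T]\big)\sum_{\sigma}\psi^{\sigma(e_1),\sigma(e_2)}\cdots\psi^{\sigma(e_{L-1}),\sigma(e_L)} ,$$ where $\mathbb I[T]$ consists of the rows of $\mathbb I$ of the edges in $T$ in increasing order, $e_1<\dots<e_L$ are the edges not in $T$, and $\sigma$ runs over all permutations of $\{e_1,\dots,e_L\}$. -/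

import Mathlib

open MeasureTheory

noncomputable section

/-- A directed graph with `n + 1` labelled vertices and `m` labelled edges; edge `e` runs from
`src e` to `tgt e`. Multiple edges and self-loops are allowed. The distinguished vertex `v⋆` is the last one. -/
structure FeynmanGraph (n m : ℕ) where
  src : Fin m → Fin (n + 1)
  tgt : Fin m → Fin (n + 1)

namespace FeynmanGraph

variable {n m : ℕ}

/-! ### Graph matrices and graph polynomials -/

/-- The incidence matrix: `-1` where an edge starts, `+1` where it ends, `0` elsewhere
(so a self-loop, if there is one, has a zero row). -/
def incidence (G : FeynmanGraph n m) : Matrix (Fin m) (Fin (n + 1)) ℝ :=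
  fun e v => (if G.tgt e = v then 1 else 0) - (if G.src e = v then 1 else 0)

/-- The reduced incidence matrix: the last column, that of `v⋆`, is left out. -/
def redIncidence (G : FeynmanGraph n m) : Matrix (Fin m) (Fin n) ℝ :=
  G.incidence.submatrix id Fin.castSucc

/-- The expanded Laplacian, with rows and columns numbered edges first, then vertices
other than `v⋆`. -/
def expandedLaplacian (G : FeynmanGraph n m) (a : Fin m → ℝ) :
    Matrix (Fin (m + n)) (Fin (m + n)) ℝ :=
  (Matrix.fromBlocks (Matrix.diagonal a) G.redIncidence (-G.redIncidence.transpose) 0).reindex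
    finSumFinEquiv finSumFinEquiv

/-- The Symanzik polynomial `ψ`, as a function of the Schwinger parameters. -/
def symanzik (G : FeynmanGraph n m) (a : Fin m → ℝ) : ℝ :=
  (G.expandedLaplacian a).det

/-- The Dodgson polynomial `ψ^{A,B}`: the determinant of the expanded Laplacian with rows `A` and
columns `B` removed, the remaining rows and columns being kept in increasing order. -/
def dodgson (G : FeynmanGraph n m) (a : Fin m → ℝ) (A B : Finset (Fin (m + n)))
    (h : A.card = B.card) : ℝ :=
  ((G.expandedLaplacian a).submatrix (Aᶜ.orderEmbOfFin rfl)
    (Bᶜ.orderEmbOfFin (by rw [Finset.card_compl, Finset.card_compl, h]))).det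

/-- The edge-indexed Dodgson polynomial `ψ^{e,f} = ψ^{{e},{f}}`. -/
def edgeDodgson (G : FeynmanGraph n m) (a : Fin m → ℝ) (e f : Fin m) : ℝ :=
  G.dodgson a {Fin.castAdd n e} {Fin.castAdd n f} rfl

/-! ### Spanning trees -/

/-- `T` is the edge set of a spanning tree: it contains no self-loops and no parallel edges, and
the simple graph that it forms on the set of all vertices is a tree. -/
structure IsSpanningTree (G : FeynmanGraph n m) (T : Finset (Fin m)) : Prop where
  loopless : ∀ e ∈ T, G.src e ≠ G.tgt e
  noParallel : Set.InjOn (fun e => s(G.src e, G.tgt e)) (T : Set (Fin m))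
  isTree : (SimpleGraph.fromEdgeSet
    ((fun e => s(G.src e, G.tgt e)) '' (T : Set (Fin m)))).IsTree

theorem IsSpanningTree.card_eq {G : FeynmanGraph n m} {T : Finset (Fin m)}
    (hT : G.IsSpanningTree T) : T.card = n := by
  classical
  have h := hT.isTree.card_edgeFinset
  have hs : (SimpleGraph.fromEdgeSet
      ((fun e => s(G.src e, G.tgt e)) '' (T : Set (Fin m)))).edgeFinset
      = T.image (fun e => s(G.src e, G.tgt e)) := by
    ext x
    simp only [SimpleGraph.mem_edgeFinset, SimpleGraph.edgeSet_fromEdgeSet, Finset.mem_image,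
      Set.mem_sdiff, Set.mem_image, Finset.mem_coe]
    constructor
    · exact fun hx => hx.1
    · rintro ⟨e, he, rfl⟩
      exact ⟨⟨e, he, rfl⟩, by simpa using hT.loopless e he⟩
  rw [hs, Finset.card_image_of_injOn hT.noParallel, Fintype.card_fin] at h
  omega

theorem IsSpanningTree.card_compl {L : ℕ} {G : FeynmanGraph n (L + n)}
    {T : Finset (Fin (L + n))} (hT : G.IsSpanningTree T) : Tᶜ.card = L := by
  rw [Finset.card_compl, hT.card_eq, Fintype.card_fin, Nat.add_sub_cancel]

/-- The square matrix `𝕀[T]`: the rows of the reduced incidence matrix that belong to the edges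
of `T`, in increasing order. -/
def redIncidenceRows (G : FeynmanGraph n m) (T : Finset (Fin m)) (hT : T.card = n) :
    Matrix (Fin n) (Fin n) ℝ :=
  G.redIncidence.submatrix (T.orderEmbOfFin hT) id

end FeynmanGraph

/-! ### Differential forms -/

/-- The wedge product `φ 0 ∧ ⋯ ∧ φ (k - 1)` of `k` covectors, normalised so that its value at
`(v 0, …, v (k - 1))` is `det (φ i (v j))`. -/
def wedgeCovectors {E : Type*} [NormedAddCommGroup E] [NormedSpace ℝ E] {k : ℕ}
    (φ : Fin k → (E →L[ℝ] ℝ)) : E [⋀^Fin k]→L[ℝ] ℝ :=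
  { (Matrix.detRowAlternating (R := ℝ) (n := Fin k)).compLinearMap
      (LinearMap.pi fun i => (φ i : E →ₗ[ℝ] ℝ)) with
    cont := by
      change Continuous fun v : Fin k → E => Matrix.det (Matrix.of fun j i => φ i (v j))
      refine Continuous.matrix_det ?_
      refine continuous_matrix fun j i => ?_
      exact (φ i).continuous.comp (continuous_apply j) }

theorem append_update {E F : Type*} [Zero F] {L n : ℕ} [DecidableEq (Fin L)] (w : Fin L → E)
    (u : Fin n → E × F) (i : Fin L) (z : E) :
    Fin.append (fun k => (Function.update w i z k, (0 : F))) u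
      = Function.update (Fin.append (fun k => (w k, (0 : F))) u) (Fin.castAdd n i) (z, 0) := by
  funext k
  refine Fin.addCases (fun j => ?_) (fun j => ?_) k
  · rcases eq_or_ne j i with rfl | hj
    · simp
    · have h : Fin.castAdd n j ≠ Fin.castAdd n i :=
        fun h' => hj (Fin.castAdd_injective L n h')
      simp [hj]
  · have h : Fin.natAdd L j ≠ Fin.castAdd n i := fun h' => by
      have := congrArg Fin.val h'
      have := i.isLt
      simp at *
      omega
    simp [Function.update_of_ne h]

/-- The contraction that underlies integration over the fibres `ℝⁿ` of `E × ℝⁿ → E`: an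
alternating `(L + n)`-form on `E × ℝⁿ` is sent to the `L`-form `η` such that `η ∧ dx₁ ∧ ⋯ ∧ dxₙ` is
its part of degree `n` in the `dx`. Differentials on `E` are written to the left of the `dx`. -/
def fiberPart {E : Type*} [NormedAddCommGroup E] [NormedSpace ℝ E] {L n : ℕ}
    (ω : (E × (Fin n → ℝ)) [⋀^Fin (L + n)]→L[ℝ] ℝ) : E [⋀^Fin L]→L[ℝ] ℝ where
  toFun w := ω (Fin.append (fun i => (w i, 0)) (fun j => (0, Pi.single j 1)))
  map_update_add' w i x y := by
    simp only [append_update]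
    rw [← ω.map_update_add, Prod.mk_add_mk, add_zero]
  map_update_smul' w i c x := by
    simp only [append_update]
    rw [← ω.map_update_smul, Prod.smul_mk, smul_zero]
  map_eq_zero_of_eq' w i j h hij := by
    refine ω.map_eq_zero_of_eq _ (i := Fin.castAdd n i) (j := Fin.castAdd n j) ?_ ?_
    · simp only [Fin.append_left, h]
    · exact fun h' => hij (Fin.castAdd_injective L n h')
  cont := by
    refine ω.cont.comp (continuous_pi fun k => ?_)
    refine Fin.addCases (fun i => ?_) (fun j => ?_) k
    · simp only [Fin.append_left]
      exact (continuous_apply i).prodMk continuous_const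
    · simp only [Fin.append_right]
      exact continuous_const

namespace FeynmanGraph

variable {n m : ℕ}

/-- The edge variable `s_e = (x_e^+ - x_e^-) / √a_e`, as a function of the Schwinger parameters and
of the positions of the vertices other than `v⋆`; the position of `v⋆` is `0`. -/
def edgeVar (G : FeynmanGraph n m) (e : Fin m) (p : (Fin m → ℝ) × (Fin n → ℝ)) : ℝ :=
  ((Fin.snoc p.2 0 : Fin (n + 1) → ℝ) (G.tgt e) - (Fin.snoc p.2 0 : Fin (n + 1) → ℝ) (G.src e))
    / √(p.1 e)

/-- The differential form `⋀_e e^{-s_e²} ds_e` (edges in increasing order) on the space of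
Schwinger parameters and vertex positions. -/
def integrandForm (G : FeynmanGraph n m) (p : (Fin m → ℝ) × (Fin n → ℝ)) :
    ((Fin m → ℝ) × (Fin n → ℝ)) [⋀^Fin m]→L[ℝ] ℝ :=
  wedgeCovectors fun e => Real.exp (-(G.edgeVar e p) ^ 2) • fderiv ℝ (G.edgeVar e) p

variable {L : ℕ}

/-- The integrand over the positions `x` in the definition of `α_Γ`, at the Schwinger
parameters `a`. The graph has `L + n` edges and `n + 1` vertices, so `L = |E| - (|V| - 1)`. -/
def alphaIntegrand (G : FeynmanGraph n (L + n)) (a : Fin (L + n) → ℝ) (x : Fin n → ℝ) :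
    (Fin (L + n) → ℝ) [⋀^Fin L]→L[ℝ] ℝ :=
  fiberPart (G.integrandForm (a, x))

/-- The differential form `α_Γ` on the space of Schwinger parameters: the integral of
`⋀_e e^{-s_e²} ds_e` over the positions of the vertices other than `v⋆`. -/
def alpha (G : FeynmanGraph n (L + n)) (a : Fin (L + n) → ℝ) :
    (Fin (L + n) → ℝ) [⋀^Fin L]→L[ℝ] ℝ :=
  ∫ x : Fin n → ℝ, G.alphaIntegrand a x

end FeynmanGraph

/-- The coefficient of `⋀_{e ∈ S} da_e` (factors in increasing order) in an `L`-form on the space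
of Schwinger parameters: its value at the coordinate vectors of `S` in increasing order. -/
def formCoeff {m L : ℕ} (S : Finset (Fin m)) (hS : S.card = L)
    (η : (Fin m → ℝ) [⋀^Fin L]→L[ℝ] ℝ) : ℝ :=
  η fun i => Pi.single (S.orderEmbOfFin hS i) 1

end

noncomputable section

/-! ### Sums over permutations and the Wick recursion -/

section Wick

variable {L p : ℕ}

/-! Write `Λ = 𝕀ᵀ diag(1/a) 𝕀`. Since `ds_e = a_e^{-1/2} (d(𝕀x)_e - (𝕀x)_e/(2a_e) da_e)`, the
coefficient of the `da_e`, `e ∉ T`, is a determinant. After row and column scalars are pulled out,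
it is a constant times `∏ (𝕀x)_e · exp(-xᵀΛx)` (`alphaIntegrand_apply_single`); the constant
contains `± det 𝕀[T]` (`det_unitRowsOver`). A spanning tree makes `Λ` positive definite, so the
integral is a Gaussian moment. Wick's theorem (`integral_gaussian_wick`) writes it as a sum over
permutations of products of covariances `(𝕀 Λ⁻¹ 𝕀ᵀ)_{ef} / 2`.

Block elimination gives `ψ = ∏ a · det Λ`, and Cramer's rule identifies the off-diagonal covariances
with `ψ^{e,f} / ψ` up to sign and factors `a_e a_f / 2` (`edgeDodgson_eq`). The signs `(-1)^e`
cancel against the shuffle sign that moves the edges outside `T` to the front. The denominator `4^L`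
collects `2^L` from differentiating `a^{-1/2}`, `2^{L/2}` from the covariances and `2^{L/2}` from
the overcounting of pairings, which also gives `(L/2)!`. -/

theorem image_mul_swap_erase {α : Type*} [DecidableEq α] (A : Finset α) {o f : α} (ho : o ∈ A)
    (hf : f ∈ A) (τ : Equiv.Perm α) :
    (A.erase f).image (τ * Equiv.swap o f) = (A.erase o).image τ := by
  have h : (A.erase f).image (Equiv.swap o f) = A.erase o := by
    ext x
    simp only [Finset.mem_image, Finset.mem_erase]
    constructor
    · rintro ⟨y, ⟨hy, hyA⟩, rfl⟩
      rcases eq_or_ne y o with rfl | hyo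
      · rw [Equiv.swap_apply_left]
        exact ⟨hy.symm, hf⟩
      · rw [Equiv.swap_apply_of_ne_of_ne hyo hy]
        exact ⟨hyo, hyA⟩
    · rintro ⟨hx, hxA⟩
      refine ⟨Equiv.swap o f x, ?_, Equiv.swap_apply_self o f x⟩
      rcases eq_or_ne x f with rfl | hxf
      · rw [Equiv.swap_apply_right]
        exact ⟨hx.symm, ho⟩
      · rw [Equiv.swap_apply_of_ne_of_ne hx hxf]
        exact ⟨hxf, hxA⟩
  rw [← h, Finset.image_image, Equiv.Perm.coe_mul]

/-- The sum over all permutations in which the first `r` pairs have been contracted. -/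
def partialWickSum (h : L = 2 * p) (J : Finset (Fin L) → ℝ) (c : Fin L → Fin L → ℝ) (r : ℕ) : ℝ :=
  ∑ σ : Equiv.Perm (Fin L),
    (∏ k : Fin p with k.val < r, c (σ ⟨2 * k, by omega⟩) (σ ⟨2 * k + 1, by omega⟩))
      * J ((Finset.univ.filter fun i : Fin L => 2 * r ≤ i.val).image σ)

/-- Apply the recursion to the first uncontracted position `2r`. Composing `σ` with a transposition
moves any partner to position `2r + 1`, so all `2(p - r) - 1` possible partners contribute equally.
-/
theorem partialWickSum_step (h : L = 2 * p) (J : Finset (Fin L) → ℝ) (c : Fin L → Fin L → ℝ)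
    (hJ : ∀ e A, e ∉ A → J (insert e A) = ∑ f ∈ A, c e f * J (A.erase f)) {r : ℕ} (hr : r < p) :
    partialWickSum h J c r = (2 * (p - r : ℕ) - 1 : ℝ) * partialWickSum h J c (r + 1) := by
  set e : Fin L := ⟨2 * r, by omega⟩ with he
  set o : Fin L := ⟨2 * r + 1, by omega⟩ with ho
  set A : Finset (Fin L) := Finset.univ.filter fun i : Fin L => 2 * r + 1 ≤ i.val with hA
  have heA : e ∉ A := by simp [hA, he]
  have hoA : o ∈ A := by simp [hA, ho]
  have hins : (Finset.univ.filter fun i : Fin L => 2 * r ≤ i.val) = insert e A := by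
    ext i
    simp only [hA, he, Finset.mem_filter, Finset.mem_univ, true_and, Finset.mem_insert, Fin.ext_iff]
    omega
  have hers : (Finset.univ.filter fun i : Fin L => 2 * (r + 1) ≤ i.val) = A.erase o := by
    ext i
    simp only [hA, ho, Finset.mem_filter, Finset.mem_univ, true_and, Finset.mem_erase, ne_eq,
      Fin.ext_iff]
    omega
  have hcard : A.card = 2 * (p - r) - 1 := by
    have : A = Finset.Ici o := by
      ext i
      simp [hA, ho, Fin.le_def]
    rw [this, Fin.card_Ici]
    simp only [ho]
    omega
  set g : Equiv.Perm (Fin L) → ℝ := fun σ =>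
    ∏ k : Fin p with k.val < r, c (σ ⟨2 * k, by omega⟩) (σ ⟨2 * k + 1, by omega⟩) with hg
  have hexp : ∀ σ : Equiv.Perm (Fin L), J ((insert e A).image σ)
      = ∑ f ∈ A, c (σ e) (σ f) * J ((A.erase f).image σ) := by
    intro σ
    have hne : σ e ∉ A.image σ := by
      simpa [Finset.mem_image] using heA
    rw [Finset.image_insert, hJ _ _ hne, Finset.sum_image (by simp)]
    refine Finset.sum_congr rfl fun f hf => ?_
    rw [Finset.image_erase σ.injective]
  have hsucc : ∀ σ : Equiv.Perm (Fin L),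
      (∏ k : Fin p with k.val < r + 1, c (σ ⟨2 * k, by omega⟩) (σ ⟨2 * k + 1, by omega⟩))
        = g σ * c (σ e) (σ o) := by
    intro σ
    have hs : (Finset.univ.filter fun k : Fin p => k.val < r + 1)
        = insert ⟨r, hr⟩ (Finset.univ.filter fun k : Fin p => k.val < r) := by
      ext k
      simp only [Finset.mem_filter, Finset.mem_univ, true_and, Finset.mem_insert, Fin.ext_iff]
      omega
    rw [hs, Finset.prod_insert (by simp), mul_comm]
  have hswap : ∀ f ∈ A, ∑ σ : Equiv.Perm (Fin L), g σ * (c (σ e) (σ f) * J ((A.erase f).image σ))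
      = ∑ σ : Equiv.Perm (Fin L), g σ * (c (σ e) (σ o) * J ((A.erase o).image σ)) := by
    intro f hf
    rw [← Equiv.sum_comp (Equiv.mulRight (Equiv.swap o f))]
    refine Finset.sum_congr rfl fun τ _ => ?_
    have hfix : ∀ i : Fin L, i ∉ A → (τ * Equiv.swap o f) i = τ i := by
      intro i hi
      rw [Equiv.Perm.mul_apply, Equiv.swap_apply_of_ne_of_ne]
      · rintro rfl; exact hi hoA
      · rintro rfl; exact hi hf
    have hgτ : g (τ * Equiv.swap o f) = g τ := by
      refine Finset.prod_congr rfl fun k hk => ?_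
      simp only [Finset.mem_filter, Finset.mem_univ, true_and] at hk
      rw [hfix, hfix] <;> simp [hA] <;> omega
    rw [Equiv.coe_mulRight, hgτ, hfix e heA, image_mul_swap_erase A hoA hf, Equiv.Perm.mul_apply,
      Equiv.swap_apply_right]
  unfold partialWickSum
  simp only [hsucc, hins, hers]
  calc ∑ σ : Equiv.Perm (Fin L), g σ * J ((insert e A).image σ)
      = ∑ f ∈ A, ∑ σ : Equiv.Perm (Fin L),
          g σ * (c (σ e) (σ f) * J ((A.erase f).image σ)) := by
        rw [Finset.sum_comm]
        refine Finset.sum_congr rfl fun σ _ => ?_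
        rw [hexp, Finset.mul_sum]
    _ = _ := by
        rw [Finset.sum_congr rfl hswap, Finset.sum_const, hcard, nsmul_eq_mul,
          Nat.cast_sub (by omega)]
        push_cast
        congr 1
        exact Finset.sum_congr rfl fun σ _ => by ring

/-- A function of finite sets that satisfies the Wick recursion is a sum over permutations of
products over consecutive pairs. -/
theorem wick_sum_perm (h : L = 2 * p) (J : Finset (Fin L) → ℝ) (c : Fin L → Fin L → ℝ)
    (hJ : ∀ e A, e ∉ A → J (insert e A) = ∑ f ∈ A, c e f * J (A.erase f)) :
    (2 ^ p * p.factorial : ℝ) * J Finset.univ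
      = J ∅ * ∑ σ : Equiv.Perm (Fin L),
          ∏ k : Fin p, c (σ ⟨2 * k, by omega⟩) (σ ⟨2 * k + 1, by omega⟩) := by
  -- Iterating the step produces `(2q - 1)!! = (2q)! / (2^q q!)`, stated here without division.
  have key : ∀ q r : ℕ, r + q = p → (2 ^ q * q.factorial : ℝ) * partialWickSum h J c r
      = (2 * q).factorial * partialWickSum h J c p := by
    intro q
    induction q with
    | zero => rintro r rfl; simp
    | succ q ih =>
      intro r hr
      have h1 := ih (r + 1) (by omega)
      rw [partialWickSum_step h J c hJ (r := r) (by omega), show p - r = q + 1 by omega,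
        show 2 * (q + 1) = 2 * q + 1 + 1 by ring, Nat.factorial_succ, Nat.factorial_succ,
        Nat.factorial_succ]
      push_cast
      linear_combination (2 * (q + 1 : ℝ) * (2 * q + 1)) * h1
  have h0 : partialWickSum h J c 0 = L.factorial * J Finset.univ := by
    simp [partialWickSum, Finset.image_univ_equiv, Finset.card_univ, Fintype.card_perm]
  have hp : partialWickSum h J c p = J ∅ * ∑ σ : Equiv.Perm (Fin L),
      ∏ k : Fin p, c (σ ⟨2 * k, by omega⟩) (σ ⟨2 * k + 1, by omega⟩) := by
    have he : (Finset.univ.filter fun i : Fin L => 2 * p ≤ i.val) = ∅ := by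
      ext i
      simp
      omega
    simp only [partialWickSum, he, Finset.image_empty, ← Finset.sum_mul]
    rw [mul_comm]
    congr 1
    refine Finset.sum_congr rfl fun σ _ => Finset.prod_congr ?_ fun _ _ => rfl
    simp
  have hk := key p 0 (by omega)
  rw [h0, hp, ← h] at hk
  have hL : (L.factorial : ℝ) ≠ 0 := by positivity
  apply mul_left_cancel₀ hL
  linear_combination hk

end Wick

/-! ### Moments of the standard Gaussian -/

section Gaussian

variable {n : ℕ} {ι : Type*}

/-- Lets each linear factor of a moment be absorbed by a small share of the Gaussian decay. -/
theorem abs_le_inv_mul_exp {δ : ℝ} (hδ : 0 < δ) (hδ1 : δ ≤ 1) (t : ℝ) :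
    |t| ≤ δ⁻¹ * Real.exp (δ * t ^ 2) := by
  have h1 : δ * t ^ 2 + 1 ≤ Real.exp (δ * t ^ 2) := Real.add_one_le_exp _
  have h2 : |t| ≤ 1 + t ^ 2 := by
    rw [← sq_abs]
    nlinarith [sq_nonneg (|t| - 1), abs_nonneg t]
  have h3 : (1 : ℝ) ≤ δ⁻¹ := (one_le_inv₀ hδ).2 hδ1
  calc |t| ≤ δ⁻¹ * (δ * t ^ 2 + 1) := by
        rw [mul_add, inv_mul_cancel_left₀ hδ.ne']
        linarith
    _ ≤ _ := by gcongr

theorem abs_dotProduct_le_exp {δ : ℝ} (hδ : 0 < δ) (hδ1 : δ ≤ 1) (u z : Fin n → ℝ) :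
    |u ⬝ᵥ z| ≤ (∑ i, |u i|) * δ⁻¹ * Real.exp (δ * (z ⬝ᵥ z)) := by
  rw [dotProduct, mul_assoc, Finset.sum_mul]
  refine (Finset.abs_sum_le_sum_abs _ _).trans (Finset.sum_le_sum fun i _ => ?_)
  rw [abs_mul]
  refine mul_le_mul_of_nonneg_left ?_ (abs_nonneg _)
  refine (abs_le_inv_mul_exp hδ hδ1 (z i)).trans ?_
  have : z i ^ 2 ≤ z ⬝ᵥ z := by
    rw [sq]
    exact Finset.single_le_sum (f := fun i => z i * z i) (fun j _ => mul_self_nonneg _)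
      (Finset.mem_univ i)
  gcongr

theorem integrable_exp_neg_mul_dotProduct {b : ℝ} (hb : 0 < b) :
    Integrable fun z : Fin n → ℝ => Real.exp (-b * (z ⬝ᵥ z)) := by
  have h : (fun z : Fin n → ℝ => Real.exp (-b * (z ⬝ᵥ z)))
      = fun z => ∏ i, Real.exp (-b * z i ^ 2) := by
    funext z
    rw [← Real.exp_sum, dotProduct, Finset.mul_sum]
    simp only [sq]
  rw [h]
  exact Integrable.fintype_prod (f := fun _ x => Real.exp (-b * x ^ 2))
    fun _ => integrable_exp_neg_mul_sq hb

theorem integral_exp_neg_dotProduct :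
    ∫ z : Fin n → ℝ, Real.exp (-(z ⬝ᵥ z)) = Real.pi ^ ((n : ℝ) / 2) := by
  have h : (fun z : Fin n → ℝ => Real.exp (-(z ⬝ᵥ z)))
      = fun z => ∏ i, Real.exp (-1 * z i ^ 2) := by
    funext z
    rw [← Real.exp_sum, dotProduct, ← Finset.sum_neg_distrib]
    simp only [sq, neg_one_mul]
  rw [h, integral_fintype_prod_volume_eq_prod (fun (_ : Fin n) x => Real.exp (-1 * x ^ 2))]
  simp only [integral_gaussian, div_one, Finset.prod_const, Finset.card_univ, Fintype.card_fin]
  rw [Real.sqrt_eq_rpow, ← Real.rpow_natCast, ← Real.rpow_mul Real.pi_pos.le]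
  congr 1
  ring

theorem integrable_prod_dotProduct_mul_exp (u : ι → Fin n → ℝ) (A : Finset ι) :
    Integrable fun z : Fin n → ℝ => (∏ k ∈ A, u k ⬝ᵥ z) * Real.exp (-(z ⬝ᵥ z)) := by
  -- With this `δ` all the factors together use up at most half of the exponent.
  set δ : ℝ := 1 / (2 * (A.card + 1)) with hδ
  have hδ0 : 0 < δ := by positivity
  have hδ1 : δ ≤ 1 := by
    rw [hδ, div_le_one (by positivity)]
    have : (0 : ℝ) ≤ A.card := by positivity
    linarith
  have hδA : A.card * δ ≤ 1 / 2 := by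
    rw [hδ, mul_one_div, div_le_div_iff₀ (by positivity) (by positivity)]
    linarith
  refine Integrable.mono' ((integrable_exp_neg_mul_dotProduct (n := n)
    (b := 1 / 2) (by norm_num)).const_mul (∏ k ∈ A, ((∑ i, |u k i|) * δ⁻¹))) ?_ ?_
  · refine Continuous.aestronglyMeasurable ?_
    fun_prop
  · refine Filter.Eventually.of_forall fun z => ?_
    have hz : 0 ≤ z ⬝ᵥ z := Finset.sum_nonneg fun i _ => mul_self_nonneg _
    rw [Real.norm_eq_abs, abs_mul, Real.abs_exp, Finset.abs_prod]
    calc (∏ k ∈ A, |u k ⬝ᵥ z|) * Real.exp (-(z ⬝ᵥ z))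
        ≤ (∏ k ∈ A, ((∑ i, |u k i|) * δ⁻¹ * Real.exp (δ * (z ⬝ᵥ z)))) * Real.exp (-(z ⬝ᵥ z)) := by
          gcongr with k hk
          exact abs_dotProduct_le_exp hδ0 hδ1 _ _
      _ = (∏ k ∈ A, ((∑ i, |u k i|) * δ⁻¹))
            * Real.exp (A.card * (δ * (z ⬝ᵥ z)) + -(z ⬝ᵥ z)) := by
          rw [Finset.prod_mul_distrib, Finset.prod_const, Real.exp_add, Real.exp_nat_mul, mul_assoc]
      _ ≤ _ := by
          have h0 : 0 ≤ ∏ k ∈ A, ((∑ i, |u k i|) * δ⁻¹) :=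
            Finset.prod_nonneg fun k _ => mul_nonneg
              (Finset.sum_nonneg fun i _ => abs_nonneg _) (by positivity)
          refine mul_le_mul_of_nonneg_left (Real.exp_le_exp.2 ?_) h0
          nlinarith

theorem hasFDerivAt_exp_neg_dotProduct (z : Fin n → ℝ) :
    ∃ f' : (Fin n → ℝ) →L[ℝ] ℝ, HasFDerivAt (fun z : Fin n → ℝ => Real.exp (-(z ⬝ᵥ z))) f' z ∧
      ∀ v, f' v = -2 * (v ⬝ᵥ z) * Real.exp (-(z ⬝ᵥ z)) := by
  have h1 : ∀ i : Fin n, HasFDerivAt (fun z : Fin n → ℝ => z i * z i) _ z := fun i =>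
    (hasFDerivAt_apply (𝕜 := ℝ) i z).mul (hasFDerivAt_apply (𝕜 := ℝ) i z)
  have h2 := (HasFDerivAt.fun_sum (u := Finset.univ) fun i _ => h1 i).neg.exp
  refine ⟨_, h2, fun v => ?_⟩
  simp only [dotProduct, Finset.mul_sum, Finset.sum_mul, smul_apply,
    neg_apply, sum_apply, add_apply,
    ContinuousLinearMap.proj_apply, smul_eq_mul, Pi.neg_apply, ← Finset.sum_neg_distrib]
  refine Finset.sum_congr rfl fun i _ => ?_
  ring

theorem hasFDerivAt_prod_dotProduct [DecidableEq ι] (u : ι → Fin n → ℝ) (A : Finset ι)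
    (z : Fin n → ℝ) :
    ∃ f' : (Fin n → ℝ) →L[ℝ] ℝ, HasFDerivAt (fun z : Fin n → ℝ => ∏ k ∈ A, u k ⬝ᵥ z) f' z ∧
      ∀ v, f' v = ∑ k ∈ A, (u k ⬝ᵥ v) * ∏ j ∈ A.erase k, u j ⬝ᵥ z := by
  let φ : ι → (Fin n → ℝ) →L[ℝ] ℝ := fun k => LinearMap.toContinuousLinearMap
    (dotProductBilin ℝ ℝ (u k))
  have h1 : ∀ k ∈ A, HasFDerivAt (fun z : Fin n → ℝ => u k ⬝ᵥ z) (φ k) z := fun k _ =>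
    (φ k).hasFDerivAt
  refine ⟨_, HasFDerivAt.finsetProd h1, fun v => ?_⟩
  simp only [sum_apply, smul_apply, smul_eq_mul]
  refine Finset.sum_congr rfl fun k _ => ?_
  rw [mul_comm]
  rfl

/-- Integration by parts: the Wick recursion for the standard Gaussian. -/
theorem integral_prod_dotProduct_insert [DecidableEq ι] (u : ι → Fin n → ℝ) (e : ι) (A : Finset ι)
    (he : e ∉ A) :
    ∫ z : Fin n → ℝ, (∏ k ∈ insert e A, u k ⬝ᵥ z) * Real.exp (-(z ⬝ᵥ z))
      = ∑ f ∈ A, (u e ⬝ᵥ u f) / 2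
          * ∫ z : Fin n → ℝ, (∏ k ∈ A.erase f, u k ⬝ᵥ z) * Real.exp (-(z ⬝ᵥ z)) := by
  have hf : ∀ z, fderiv ℝ (fun z : Fin n → ℝ => ∏ k ∈ A, u k ⬝ᵥ z) z (u e)
      = ∑ k ∈ A, (u k ⬝ᵥ u e) * ∏ j ∈ A.erase k, u j ⬝ᵥ z := fun z => by
    obtain ⟨f', h1, h2⟩ := hasFDerivAt_prod_dotProduct u A z
    rw [h1.fderiv, h2]
  have hg : ∀ z, fderiv ℝ (fun z : Fin n → ℝ => Real.exp (-(z ⬝ᵥ z))) z (u e)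
      = -2 * (u e ⬝ᵥ z) * Real.exp (-(z ⬝ᵥ z)) := fun z => by
    obtain ⟨f', h1, h2⟩ := hasFDerivAt_exp_neg_dotProduct z
    rw [h1.fderiv, h2]
  have hint : ∀ f ∈ A, Integrable fun z : Fin n → ℝ =>
      (u f ⬝ᵥ u e) * ((∏ k ∈ A.erase f, u k ⬝ᵥ z) * Real.exp (-(z ⬝ᵥ z))) := fun f _ =>
    (integrable_prod_dotProduct_mul_exp u (A.erase f)).const_mul _
  have hfg : (fun z => fderiv ℝ (fun z : Fin n → ℝ => ∏ k ∈ A, u k ⬝ᵥ z) z (u e)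
        * Real.exp (-(z ⬝ᵥ z)))
      = fun z => ∑ f ∈ A, (u f ⬝ᵥ u e) *
          ((∏ k ∈ A.erase f, u k ⬝ᵥ z) * Real.exp (-(z ⬝ᵥ z))) := by
    funext z
    rw [hf, Finset.sum_mul]
    simp only [mul_assoc]
  have hgf : (fun z => (∏ k ∈ A, u k ⬝ᵥ z)
        * fderiv ℝ (fun z : Fin n → ℝ => Real.exp (-(z ⬝ᵥ z))) z (u e))
      = fun z => (-2) * ((∏ k ∈ insert e A, u k ⬝ᵥ z) * Real.exp (-(z ⬝ᵥ z))) := by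
    funext z
    rw [hg, Finset.prod_insert he]
    ring
  -- Differentiating the Gaussian along `u e` produces `-2 (u e ⬝ᵥ z)`: this is the factor to be
  -- removed, and the source of the `1/2` in the covariance.
  have hparts := integral_mul_fderiv_eq_neg_fderiv_mul_of_integrable
    (μ := (volume : Measure (Fin n → ℝ))) (v := u e)
    (f := fun z : Fin n → ℝ => ∏ k ∈ A, u k ⬝ᵥ z)
    (g := fun z : Fin n → ℝ => Real.exp (-(z ⬝ᵥ z)))
    (by rw [hfg]; exact integrable_finsetSum _ hint)
    (by rw [hgf]; exact (integrable_prod_dotProduct_mul_exp u (insert e A)).const_mul _)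
    (integrable_prod_dotProduct_mul_exp u A)
    (fun z _ => (hasFDerivAt_prod_dotProduct u A z).choose_spec.1.differentiableAt)
    (fun z _ => (hasFDerivAt_exp_neg_dotProduct z).choose_spec.1.differentiableAt)
  rw [hfg, hgf, integral_const_mul, integral_finsetSum _ hint] at hparts
  simp only [integral_const_mul] at hparts
  rw [← mul_right_inj' (two_ne_zero' ℝ), Finset.mul_sum]
  rw [neg_mul, neg_inj] at hparts
  rw [hparts]
  refine Finset.sum_congr rfl fun f _ => ?_
  rw [dotProduct_comm (u f)]
  ring

/-- Wick's theorem for the Gaussian with density `exp (-xᵀ Λ x)`, where `Λ = Rᵀ R` and the covariance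
matrix is half the inverse of `Λ`. -/
theorem integral_gaussian_wick {L p : ℕ} (h : L = 2 * p) (R : Matrix (Fin n) (Fin n) ℝ)
    (hR : R.det ≠ 0) (u : Fin L → Fin n → ℝ) :
    (Integrable fun x : Fin n → ℝ =>
      (∏ k, u k ⬝ᵥ x) * Real.exp (-(R.mulVec x ⬝ᵥ R.mulVec x))) ∧
    (2 ^ p * p.factorial : ℝ) *
        ∫ x : Fin n → ℝ, (∏ k, u k ⬝ᵥ x) * Real.exp (-(R.mulVec x ⬝ᵥ R.mulVec x))
      = |R.det|⁻¹ * Real.pi ^ ((n : ℝ) / 2) * ∑ σ : Equiv.Perm (Fin L), ∏ k : Fin p,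
          (u (σ ⟨2 * k, by omega⟩) ⬝ᵥ
            ((R.transpose * R)⁻¹).mulVec (u (σ ⟨2 * k + 1, by omega⟩))) / 2 := by
  have hu : IsUnit R.det := isUnit_iff_ne_zero.2 hR
  -- Under the substitution `z = R x`, the functional `u k ⬝ᵥ x` becomes `w k ⬝ᵥ z`.
  set w : Fin L → Fin n → ℝ := fun k => (R⁻¹).transpose.mulVec (u k) with hw
  set F : (Fin n → ℝ) → ℝ := fun z => (∏ k, w k ⬝ᵥ z) * Real.exp (-(z ⬝ᵥ z)) with hF
  have hFint : Integrable F := integrable_prod_dotProduct_mul_exp w Finset.univ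
  have hcomp : (fun x : Fin n → ℝ =>
      (∏ k, u k ⬝ᵥ x) * Real.exp (-(R.mulVec x ⬝ᵥ R.mulVec x))) = F ∘ R.toLin' := by
    funext x
    simp only [hF, hw, Function.comp_apply, Matrix.toLin'_apply]
    congr 1
    refine Finset.prod_congr rfl fun k _ => ?_
    rw [Matrix.mulVec_transpose, ← Matrix.dotProduct_mulVec, Matrix.mulVec_mulVec,
      Matrix.nonsing_inv_mul _ hu, Matrix.one_mulVec]
  have hmap := Real.map_matrix_volume_pi_eq_smul_volume_pi hR
  have hmeas : Measurable R.toLin' := (LinearMap.continuous_on_pi _).measurable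
  have hFm : AEStronglyMeasurable F (Measure.map R.toLin' volume) := by
    refine Continuous.aestronglyMeasurable ?_
    fun_prop
  have hint : Integrable (F ∘ R.toLin') := by
    rw [← integrable_map_measure hFm hmeas.aemeasurable, hmap]
    exact hFint.smul_measure ENNReal.ofReal_ne_top
  have hval : ∫ x, (F ∘ R.toLin') x = |R.det|⁻¹ * ∫ z, F z := by
    simp only [Function.comp_apply]
    rw [← integral_map hmeas.aemeasurable hFm, hmap, integral_smul_measure, abs_inv,
      ENNReal.toReal_ofReal (by positivity), smul_eq_mul]
  refine ⟨hcomp ▸ hint, ?_⟩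
  rw [hcomp, hval]
  have hwick := wick_sum_perm h
    (fun A => ∫ z : Fin n → ℝ, (∏ k ∈ A, w k ⬝ᵥ z) * Real.exp (-(z ⬝ᵥ z)))
    (fun e f => (w e ⬝ᵥ w f) / 2) (fun e A he => integral_prod_dotProduct_insert w e A he)
  simp only [Finset.prod_empty, one_mul, integral_exp_neg_dotProduct] at hwick
  have hc : ∀ e f, w e ⬝ᵥ w f = u e ⬝ᵥ ((R.transpose * R)⁻¹).mulVec (u f) := by
    intro e f
    simp only [hw]
    rw [Matrix.mulVec_transpose, ← Matrix.dotProduct_mulVec, Matrix.mulVec_mulVec,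
      Matrix.mul_inv_rev, Matrix.transpose_nonsing_inv]
  simp only [hc] at hwick
  linear_combination |R.det|⁻¹ * hwick

end Gaussian

/-! ### Determinants -/

section Determinants

variable {n m L p : ℕ}

/-- Ties Dodgson determinants to cofactors: the increasing enumeration that omits one index is
`Fin.succAbove`. -/
theorem det_submatrix_compl_singleton {N k : ℕ} (M : Matrix (Fin N) (Fin N) ℝ) (i j : Fin N)
    (hi : ({i}ᶜ : Finset (Fin N)).card = k) (hj : ({j}ᶜ : Finset (Fin N)).card = k) :
    (M.submatrix (({i}ᶜ : Finset (Fin N)).orderEmbOfFin hi)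
        (({j}ᶜ : Finset (Fin N)).orderEmbOfFin hj)).det
      = (-1) ^ (i.val + j.val) * M.adjugate j i := by
  obtain _ | N := N
  · exact i.elim0
  have hk : k = N := by
    rw [← hi]
    simp [Finset.card_compl]
  subst hk
  rw [Matrix.adjugate_fin_succ_eq_det_submatrix, ← mul_assoc, ← pow_add,
    Even.neg_one_pow ⟨_, rfl⟩, one_mul]
  congr 2 <;> funext x <;> rw [Finset.orderEmbOfFin_compl_singleton_apply] <;> rfl

/-- The sign of a permutation that is increasing on the first `L` and on the last `n` indices. -/
theorem sign_shuffle (π : Equiv.Perm (Fin (L + n)))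
    (h1 : StrictMono fun k : Fin L => π (Fin.castAdd n k))
    (h2 : StrictMono fun j : Fin n => π (Fin.natAdd L j)) :
    Equiv.Perm.sign π = (-1) ^ (∑ k : Fin L, ((π (Fin.castAdd n k)).val + k.val)) := by
  rw [Equiv.Perm.sign_eq_prod_prod_Ioi, Fin.prod_univ_add]
  have hR : ∏ j : Fin n, ∏ i ∈ Finset.Ioi (Fin.natAdd L j),
      (if π (Fin.natAdd L j) < π i then (1 : ℤˣ) else -1) = 1 := by
    refine Finset.prod_eq_one fun j _ => Finset.prod_eq_one fun i hi => ?_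
    rw [Finset.mem_Ioi] at hi
    induction i using Fin.addCases with
    | left i =>
      rw [Fin.lt_def] at hi
      simp at hi
      omega
    | right i =>
      rw [if_pos]
      refine h2 ?_
      rw [Fin.lt_def] at hi ⊢
      simpa using hi
  rw [hR, mul_one, ← Finset.prod_pow_eq_pow_sum]
  refine Finset.prod_congr rfl fun k _ => ?_
  set i := Fin.castAdd n k with hi
  have hnot : ∀ j : Fin (L + n), (if π i < π j then (1 : ℤˣ) else -1)
      = if ¬ (π i < π j) then -1 else 1 := fun j => by split_ifs <;> rfl
  simp only [hnot]
  rw [Finset.prod_ite, Finset.prod_const, Finset.prod_const_one, mul_one]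
  set A := (Finset.Ioi i).filter fun j => ¬ (π i < π j) with hA
  -- The values below `π i` are taken at the `k` earlier positions, by monotonicity, or at the later
  -- positions that form inversions with `i`.
  have hcard : A.card + k.val = (π i).val := by
    have hunion : (Finset.Iio (π i)).map π.symm.toEmbedding = A ∪ Finset.Iio i := by
      ext j
      simp only [Finset.mem_map_equiv, Equiv.symm_symm, Finset.mem_Iio, Finset.mem_union, hA,
        Finset.mem_filter, Finset.mem_Ioi, not_lt]
      constructor
      · intro hj
        rcases lt_trichotomy i j with h | h | h
        · exact Or.inl ⟨h, hj.le⟩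
        · exact absurd (h ▸ hj) (lt_irrefl _)
        · exact Or.inr h
      · rintro (⟨hij, hj⟩ | hj)
        · exact lt_of_le_of_ne hj fun h => hij.ne' (π.injective h)
        · have hjL : j.val < L := lt_trans (Fin.lt_def.1 hj) (by simp [hi])
          obtain ⟨j', rfl⟩ : ∃ j' : Fin L, j = Fin.castAdd n j' := ⟨⟨j, hjL⟩, rfl⟩
          exact h1 (Fin.lt_def.2 (Fin.lt_def.1 hj))
    have hdisj : Disjoint A (Finset.Iio i) := by
      rw [Finset.disjoint_left]
      intro j hj hj'
      simp only [hA, Finset.mem_filter, Finset.mem_Ioi] at hj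
      exact lt_asymm hj.1 (Finset.mem_Iio.1 hj')
    have h := congrArg Finset.card hunion
    rw [Finset.card_map, Fin.card_Iio, Finset.card_union_of_disjoint hdisj, Fin.card_Iio] at h
    simpa [hi] using h.symm
  rw [← hcard, add_assoc, pow_add _ _ (k.val + k.val), Even.neg_one_pow ⟨_, rfl⟩, mul_one]

/-- Each further pair of indices adds the odd number `4p + 1` to the sum. -/
theorem sum_fin_val_parity (h : L = 2 * p) : (-1 : ℝ) ^ (∑ k : Fin L, k.val) = (-1) ^ p := by
  subst h
  rw [Fin.sum_univ_eq_sum_range (fun k => k)]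
  induction p with
  | zero => simp
  | succ p ih =>
    rw [show 2 * (p + 1) = 2 * p + 1 + 1 by ring, Finset.sum_range_succ, Finset.sum_range_succ,
      add_assoc, pow_add, ih, pow_succ, show 2 * p + (2 * p + 1) = 2 * (2 * p) + 1 by ring,
      pow_succ (-1 : ℝ) (2 * (2 * p)), pow_mul]
    simp

/-- Rows of coordinate vectors indexed by `e`, on top of the matrix `C`. -/
def unitRowsOver (e : Fin L → Fin (L + n)) (C : Matrix (Fin n) (Fin (L + n)) ℝ) :
    Matrix (Fin (L + n)) (Fin (L + n)) ℝ :=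
  Matrix.of (Fin.addCases (fun k => Pi.single (e k) 1) fun j => C j)

/-- Moving the columns of `Tᶜ` to the front makes the matrix block lower triangular with an identity
block; the sign is that of the shuffle. -/
theorem det_unitRowsOver (C : Matrix (Fin n) (Fin (L + n)) ℝ) (T : Finset (Fin (L + n)))
    (hT : T.card = n) (hS : Tᶜ.card = L) :
    (unitRowsOver (Tᶜ.orderEmbOfFin hS) C).det
      = (-1) ^ (∑ k : Fin L, ((Tᶜ.orderEmbOfFin hS k).val + k.val))
        * (C.submatrix id (T.orderEmbOfFin hT)).det := by
  set eqv : Fin L ⊕ Fin n ≃ Fin (L + n) :=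
    (Equiv.sumComm _ _).trans (finSumEquivOfFinset hT hS) with heqv
  have hl : ∀ k, eqv (Sum.inl k) = Tᶜ.orderEmbOfFin hS k := fun k => by simp [heqv]
  have hr : ∀ j, eqv (Sum.inr j) = T.orderEmbOfFin hT j := fun k => by simp [heqv]
  set π : Equiv.Perm (Fin (L + n)) := finSumFinEquiv.symm.trans eqv with hπ
  have hπl : ∀ k, π (Fin.castAdd n k) = Tᶜ.orderEmbOfFin hS k := fun k => by simp [hπ, hl]
  have hπr : ∀ j, π (Fin.natAdd L j) = T.orderEmbOfFin hT j := fun k => by simp [hπ, hr]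
  set N := unitRowsOver (Tᶜ.orderEmbOfFin hS) C with hN
  have hblocks : (N.submatrix id π).submatrix finSumFinEquiv finSumFinEquiv
      = Matrix.fromBlocks 1 0 (C.submatrix id (Tᶜ.orderEmbOfFin hS))
          (C.submatrix id (T.orderEmbOfFin hT)) := by
    ext i j
    have hmem : ∀ j, T.orderEmbOfFin hT j ∈ T := fun j => T.orderEmbOfFin_mem hT j
    have hmem' : ∀ j, Tᶜ.orderEmbOfFin hS j ∉ T := fun j =>
      Finset.mem_compl.1 (Tᶜ.orderEmbOfFin_mem hS j)
    rcases i with i | i <;> rcases j with j | j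
    · simp [hN, unitRowsOver, hπl, Matrix.one_apply, Pi.single_apply, eq_comm]
    · simp [hN, unitRowsOver, hπr, Pi.single_apply]
      intro h
      exact hmem' i (h ▸ hmem j)
    · simp [hN, unitRowsOver, hπl]
    · simp [hN, unitRowsOver, hπr]
  have hdet : (N.submatrix id π).det = (C.submatrix id (T.orderEmbOfFin hT)).det := by
    rw [← Matrix.det_submatrix_equiv_self finSumFinEquiv, hblocks, Matrix.det_fromBlocks_zero₁₂,
      Matrix.det_one, one_mul]
  rw [Matrix.det_permute', sign_shuffle π
    (by simpa only [hπl] using (Tᶜ.orderEmbOfFin hS).strictMono)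
    (by simpa only [hπr] using (T.orderEmbOfFin hT).strictMono)] at hdet
  simp only [hπl] at hdet
  rw [← hdet, ← mul_assoc]
  push_cast
  rw [← pow_add, Even.neg_one_pow ⟨_, rfl⟩, one_mul]

theorem prod_pairs {M : Type*} [CommMonoid M] (h : L = 2 * p) (g : Fin L → M) :
    ∏ k : Fin p, (g ⟨2 * k, by omega⟩ * g ⟨2 * k + 1, by omega⟩) = ∏ i, g i := by
  subst h
  induction p with
  | zero => simp
  | succ p ih =>
    rw [Fin.prod_univ_castSucc]
    have := ih fun i => g ⟨i, by omega⟩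
    simp only [Fin.val_castSucc, Fin.val_last]
    rw [this]
    symm
    change ∏ i : Fin (2 * p + 1 + 1), g i = _
    rw [Fin.prod_univ_castSucc, Fin.prod_univ_castSucc, mul_assoc]
    rfl

/-! ### The weighted Laplacian -/

/-- The reduced Laplacian with weights `1 / a`. -/
def weightedLaplacian (B : Matrix (Fin m) (Fin n) ℝ) (a : Fin m → ℝ) : Matrix (Fin n) (Fin n) ℝ :=
  B.transpose * Matrix.diagonal (fun e => (a e)⁻¹) * B

theorem dotProduct_weightedLaplacian (B : Matrix (Fin m) (Fin n) ℝ) {a : Fin m → ℝ}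
    (x : Fin n → ℝ) :
    x ⬝ᵥ (weightedLaplacian B a).mulVec x = ∑ e, (B.mulVec x e) ^ 2 / a e := by
  rw [weightedLaplacian, ← Matrix.mulVec_mulVec, ← Matrix.mulVec_mulVec, Matrix.dotProduct_mulVec,
    Matrix.vecMul_transpose, dotProduct]
  refine Finset.sum_congr rfl fun e _ => ?_
  rw [Matrix.mulVec_diagonal]
  ring

theorem weightedLaplacian_posDef (B : Matrix (Fin m) (Fin n) ℝ) {a : Fin m → ℝ}
    (ha : ∀ e, 0 < a e) (hB : ∀ x, B.mulVec x = 0 → x = 0) : (weightedLaplacian B a).PosDef := by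
  refine Matrix.posDef_iff_dotProduct_mulVec.2 ⟨?_, fun x hx => ?_⟩
  · rw [Matrix.IsHermitian, Matrix.conjTranspose_eq_transpose_of_trivial, weightedLaplacian]
    simp [Matrix.transpose_mul, Matrix.mul_assoc]
  · rw [star_trivial, dotProduct_weightedLaplacian]
    have hne : B.mulVec x ≠ 0 := fun h => hx (hB x h)
    obtain ⟨e, he⟩ := Function.ne_iff.1 hne
    refine Finset.sum_pos' (fun e _ => div_nonneg (sq_nonneg _) (ha e).le)
      ⟨e, Finset.mem_univ e, div_pos (sq_pos_iff.2 he) (ha e)⟩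

/-- Supplies the substitution that standardises the Gaussian, together with its Jacobian. -/
theorem exists_transpose_mul_self_of_posDef {A : Matrix (Fin n) (Fin n) ℝ} (hA : A.PosDef) :
    ∃ R : Matrix (Fin n) (Fin n) ℝ, R.transpose * R = A ∧ R.det ≠ 0 ∧ |R.det| = √A.det := by
  open scoped MatrixOrder in
  obtain ⟨R, hR⟩ := CStarAlgebra.nonneg_iff_eq_star_mul_self.1 hA.posSemidef.nonneg
  have h : R.transpose * R = A := by
    rw [hR, Matrix.star_eq_conjTranspose, Matrix.conjTranspose_eq_transpose_of_trivial]
  have hd : A.det = R.det ^ 2 := by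
    rw [← h, Matrix.det_mul, Matrix.det_transpose, sq]
  refine ⟨R, h, fun h0 => ?_, by rw [hd, Real.sqrt_sq_eq_abs]⟩
  have := hA.det_pos
  rw [hd, h0] at this
  simp at this

/-- The weighted Laplacian is the Schur complement of the diagonal block. -/
theorem det_fromBlocks_laplacian (B : Matrix (Fin m) (Fin n) ℝ) {a : Fin m → ℝ}
    (ha : ∀ e, 0 < a e) :
    (Matrix.fromBlocks (Matrix.diagonal a) B (-B.transpose) 0).det
      = (∏ e, a e) * (weightedLaplacian B a).det := by
  have hinv : Matrix.diagonal (fun e => (a e)⁻¹) * Matrix.diagonal a = 1 := by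
    rw [Matrix.diagonal_mul_diagonal, ← Matrix.diagonal_one]
    congr 1
    funext e
    exact inv_mul_cancel₀ (ha e).ne'
  let : Invertible (Matrix.diagonal a) := ⟨Matrix.diagonal fun e => (a e)⁻¹, hinv,
    mul_eq_one_comm.1 hinv⟩
  rw [Matrix.det_fromBlocks₁₁, Matrix.det_diagonal, weightedLaplacian]
  congr 2
  change 0 - -B.transpose * Matrix.diagonal (fun e => (a e)⁻¹) * B = _
  simp

/-- The edge block of the inverse is `D - D B Λ⁻¹ Bᵀ D`; the first term is diagonal and drops out
for `e ≠ f`. -/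
theorem inv_fromBlocks_laplacian (B : Matrix (Fin m) (Fin n) ℝ) {a : Fin m → ℝ}
    (ha : ∀ e, 0 < a e) (hdet : (weightedLaplacian B a).det ≠ 0) {e f : Fin m} (hef : e ≠ f) :
    (Matrix.fromBlocks (Matrix.diagonal a) B (-B.transpose) 0)⁻¹ (Sum.inl e) (Sum.inl f)
      = -((a e)⁻¹ * (B * (weightedLaplacian B a)⁻¹ * B.transpose) e f * (a f)⁻¹) := by
  set D := Matrix.diagonal fun e => (a e)⁻¹ with hD
  set Λ := weightedLaplacian B a with hΛ
  have hinv : Matrix.diagonal a * D = 1 := by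
    rw [hD, Matrix.diagonal_mul_diagonal, ← Matrix.diagonal_one]
    congr 1
    funext e
    exact mul_inv_cancel₀ (ha e).ne'
  have hΛi : Λ * Λ⁻¹ = 1 := Matrix.mul_nonsing_inv _ (isUnit_iff_ne_zero.2 hdet)
  have hBDB : B.transpose * D * B = Λ := rfl
  have key : Matrix.fromBlocks (Matrix.diagonal a) B (-B.transpose) 0
      * Matrix.fromBlocks (D - D * B * Λ⁻¹ * B.transpose * D) (-(D * B * Λ⁻¹))
          (Λ⁻¹ * B.transpose * D) Λ⁻¹ = 1 := by
    rw [Matrix.fromBlocks_multiply, ← Matrix.fromBlocks_one]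
    congr 1
    · rw [Matrix.mul_sub, hinv]
      simp only [← Matrix.mul_assoc, hinv, Matrix.one_mul]
      abel
    · rw [Matrix.mul_neg]
      simp only [← Matrix.mul_assoc, hinv, Matrix.one_mul]
      abel
    · rw [Matrix.mul_sub]
      simp only [Matrix.neg_mul, Matrix.zero_mul, ← Matrix.mul_assoc, hBDB, hΛi, Matrix.one_mul]
      abel
    · simp only [Matrix.neg_mul, Matrix.mul_neg, Matrix.zero_mul, ← Matrix.mul_assoc, hBDB, hΛi]
      simp
  rw [Matrix.inv_eq_right_inv key, Matrix.fromBlocks_apply₁₁, Matrix.sub_apply, hD,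
    Matrix.mul_diagonal, Matrix.diagonal_apply_ne _ hef, Matrix.mul_assoc (Matrix.diagonal _),
    Matrix.mul_assoc (Matrix.diagonal _), Matrix.diagonal_mul, zero_sub]

end Determinants

/-! ### Graph polynomials via the weighted Laplacian, and connectedness. -/

namespace FeynmanGraph

variable {n m : ℕ}

theorem symanzik_eq (G : FeynmanGraph n m) {a : Fin m → ℝ} (ha : ∀ e, 0 < a e) :
    G.symanzik a = (∏ e, a e) * (weightedLaplacian G.redIncidence a).det := by
  rw [symanzik, expandedLaplacian, Matrix.det_reindex_self, det_fromBlocks_laplacian _ ha]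

/-- Cramer's rule: removing row `e` and column `f` gives the entry `(f, e)` of the adjugate, hence
of `ψ` times the inverse. -/
theorem edgeDodgson_eq (G : FeynmanGraph n m) {a : Fin m → ℝ} (ha : ∀ e, 0 < a e)
    (hdet : (weightedLaplacian G.redIncidence a).det ≠ 0) {e f : Fin m} (hef : e ≠ f) :
    G.edgeDodgson a e f = -((-1) ^ (e.val + f.val) * G.symanzik a * ((a f)⁻¹ *
      (G.redIncidence * (weightedLaplacian G.redIncidence a)⁻¹ * G.redIncidence.transpose) f e
        * (a e)⁻¹)) := by
  have hψ : G.symanzik a ≠ 0 := by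
    rw [G.symanzik_eq ha]
    exact mul_ne_zero (Finset.prod_pos fun e _ => ha e).ne' hdet
  have hadj : (G.expandedLaplacian a).adjugate (Fin.castAdd n f) (Fin.castAdd n e)
      = G.symanzik a * (G.expandedLaplacian a)⁻¹ (Fin.castAdd n f) (Fin.castAdd n e) := by
    rw [Matrix.inv_def, Matrix.smul_apply, smul_eq_mul, Ring.inverse_eq_inv', ← mul_assoc]
    change _ = G.symanzik a * (G.symanzik a)⁻¹ * _
    rw [mul_inv_cancel₀ hψ, one_mul]
  have hinv := inv_fromBlocks_laplacian G.redIncidence ha hdet hef.symm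
  unfold edgeDodgson dodgson
  rw [det_submatrix_compl_singleton, hadj, expandedLaplacian,
    Matrix.inv_reindex, Matrix.reindex_apply, Matrix.submatrix_apply]
  simp only [finSumFinEquiv_symm_apply_castAdd, hinv, Fin.val_castAdd]
  ring

theorem redIncidence_mulVec (G : FeynmanGraph n m) (x : Fin n → ℝ) (e : Fin m) :
    G.redIncidence.mulVec x e = (Fin.snoc x 0 : Fin (n + 1) → ℝ) (G.tgt e)
      - (Fin.snoc x 0 : Fin (n + 1) → ℝ) (G.src e) := by
  have h : ∀ v : Fin (n + 1), ∑ j : Fin n, (if v = j.castSucc then (1 : ℝ) else 0) * x j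
      = (Fin.snoc x 0 : Fin (n + 1) → ℝ) v := by
    intro v
    induction v using Fin.lastCases with
    | last => simp [(Fin.castSucc_ne_last _).symm]
    | cast v => simp
  simp only [Matrix.mulVec, dotProduct, redIncidence, Matrix.submatrix_apply, id, incidence, sub_mul,
    Finset.sum_sub_distrib, h]

/-- Such positions agree at the two ends of every edge, and the tree joins every vertex to `v⋆`,
whose position is `0`. -/
theorem IsSpanningTree.eq_zero_of_mulVec_eq_zero {G : FeynmanGraph n m} {T : Finset (Fin m)}
    (hT : G.IsSpanningTree T) (x : Fin n → ℝ) (hx : G.redIncidence.mulVec x = 0) : x = 0 := by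
  set y : Fin (n + 1) → ℝ := Fin.snoc x 0 with hy
  have hedge : ∀ e, y (G.tgt e) = y (G.src e) := fun e => by
    have := congrFun hx e
    rw [redIncidence_mulVec, Pi.zero_apply] at this
    exact sub_eq_zero.1 this
  have hreach : ∀ v, y v = y (Fin.last n) := by
    intro v
    obtain ⟨w⟩ := hT.isTree.connected.preconnected v (Fin.last n)
    generalize Fin.last n = u at w
    induction w with
    | nil => rfl
    | cons hadj _ ih =>
      rw [SimpleGraph.fromEdgeSet_adj] at hadj
      obtain ⟨⟨e, -, he⟩, -⟩ := hadj
      rw [← ih]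
      rcases Sym2.eq_iff.1 he with ⟨h1, h2⟩ | ⟨h1, h2⟩
      · rw [← h1, ← h2, hedge]
      · rw [← h1, ← h2, hedge]
  funext j
  have := hreach j.castSucc
  simpa [hy] using this

end FeynmanGraph

/-! ### Integrating forms coefficient by coefficient -/

section Forms

variable {m L : ℕ}

/-- The coefficients of an `L`-form on `ℝᵐ`, as a linear map. -/
def formCoeffs (m L : ℕ) :
    ((Fin m → ℝ) [⋀^Fin L]→L[ℝ] ℝ) →ₗ[ℝ] ((Fin L → Fin m) → ℝ) where
  toFun η e := η fun k => Pi.single (e k) 1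
  map_add' _ _ := rfl
  map_smul' _ _ := rfl

theorem formCoeffs_injective : Function.Injective (formCoeffs m L) := by
  intro η ξ h
  apply ContinuousAlternatingMap.toAlternatingMap_injective
  refine Module.Basis.ext_alternating (Pi.basisFun ℝ (Fin m)) fun e _ => ?_
  simpa [formCoeffs] using congrFun h e

/-- Makes the coefficient functionals continuous, so that they commute with the integral of forms.
-/
instance finiteDimensional_forms : FiniteDimensional ℝ ((Fin m → ℝ) [⋀^Fin L]→L[ℝ] ℝ) :=
  FiniteDimensional.of_injective (formCoeffs m L) formCoeffs_injective

/-- A linear left inverse of `formCoeffs` is continuous and carries integrability back from the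
coefficients. -/
theorem integrable_form {X : Type*} [MeasurableSpace X] {μ : Measure X}
    {η : X → (Fin m → ℝ) [⋀^Fin L]→L[ℝ] ℝ}
    (h : ∀ e : Fin L → Fin m, Integrable (fun x => η x fun k => Pi.single (e k) 1) μ) :
    Integrable η μ := by
  obtain ⟨g, hg⟩ := (formCoeffs m L).exists_leftInverse_of_injective
    (LinearMap.ker_eq_bot.2 formCoeffs_injective)
  have hc : Integrable (fun x => formCoeffs m L (η x)) μ := Integrable.of_eval h
  have := (LinearMap.toContinuousLinearMap g).integrable_comp hc
  refine this.congr (Filter.Eventually.of_forall fun x => ?_)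
  exact LinearMap.congr_fun hg (η x)

theorem integral_form_apply {X : Type*} [MeasurableSpace X] {μ : Measure X}
    {η : X → (Fin m → ℝ) [⋀^Fin L]→L[ℝ] ℝ} (h : Integrable η μ) (e : Fin L → Fin m) :
    (∫ x, η x ∂μ) (fun k => Pi.single (e k) 1) = ∫ x, η x (fun k => Pi.single (e k) 1) ∂μ :=
  ((LinearMap.toContinuousLinearMap ((LinearMap.proj e).comp (formCoeffs m L))).integral_comp_comm
    h).symm

end Forms

/-! ### The integrand in coordinates. -/

namespace FeynmanGraph

variable {n m L : ℕ}

theorem fderiv_edgeVar (G : FeynmanGraph n m) (e : Fin m) {a : Fin m → ℝ} (ha : 0 < a e)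
    (x : Fin n → ℝ) (w : Fin m → ℝ) (y : Fin n → ℝ) :
    fderiv ℝ (G.edgeVar e) (a, x) (w, y)
      = (√(a e))⁻¹ * (G.redIncidence.mulVec y e - G.redIncidence.mulVec x e / (2 * a e) * w e) := by
  have hfun : G.edgeVar e = fun p => G.redIncidence.mulVec p.2 e * (√(p.1 e))⁻¹ := by
    funext p
    rw [redIncidence_mulVec, edgeVar, div_eq_mul_inv]
  let φ : ((Fin m → ℝ) × (Fin n → ℝ)) →L[ℝ] ℝ := (LinearMap.toContinuousLinearMap
    ((LinearMap.proj e).comp G.redIncidence.mulVecLin)).comp (ContinuousLinearMap.snd ℝ _ _)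
  let χ : ((Fin m → ℝ) × (Fin n → ℝ)) →L[ℝ] ℝ :=
    (ContinuousLinearMap.proj e).comp (ContinuousLinearMap.fst ℝ _ _)
  have h1 : HasFDerivAt (fun p : (Fin m → ℝ) × (Fin n → ℝ) => G.redIncidence.mulVec p.2 e) φ
    (a, x) := φ.hasFDerivAt
  have h2 : HasFDerivAt (fun p : (Fin m → ℝ) × (Fin n → ℝ) => p.1 e) χ (a, x) := χ.hasFDerivAt
  have hs : √(a e) ≠ 0 := (Real.sqrt_pos.2 ha).ne'
  have h3 := (Real.hasDerivAt_sqrt ha.ne').fun_inv hs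
  have h4 := h1.mul (h3.comp_hasFDerivAt (f := fun p : (Fin m → ℝ) × (Fin n → ℝ) => p.1 e) (a, x) h2)
  rw [hfun]
  refine (congrArg (fun F : ((Fin m → ℝ) × (Fin n → ℝ)) →L[ℝ] ℝ => F (w, y)) h4.fderiv).trans ?_
  have hφ : φ (w, y) = G.redIncidence.mulVec y e := rfl
  have hχ : χ (w, y) = w e := rfl
  simp only [add_apply, smul_apply, smul_eq_mul, hφ, hχ, Function.comp_apply]
  rw [Real.sq_sqrt ha.le]
  field_simp
  ring

/-- The coefficient of `da_{e 0} ∧ ⋯ ∧ da_{e (L - 1)} ∧ dx_1 ∧ ⋯ ∧ dx_n` in the integrand of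
`α_Γ`. -/
theorem alphaIntegrand_apply_single (G : FeynmanGraph n (L + n)) {a : Fin (L + n) → ℝ}
    (ha : ∀ e, 0 < a e) (x : Fin n → ℝ) (e : Fin L → Fin (L + n)) :
    G.alphaIntegrand a x (fun k => Pi.single (e k) 1)
      = ((∏ i, (√(a i))⁻¹) * (∏ k, (-(2 * a (e k))⁻¹))
          * (unitRowsOver e G.redIncidence.transpose).det)
        * ((∏ k, G.redIncidence (e k) ⬝ᵥ x)
          * Real.exp (-(x ⬝ᵥ (weightedLaplacian G.redIncidence a).mulVec x))) := by
  set s : Fin (L + n) → ℝ := fun i => G.edgeVar i (a, x) with hs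
  set r : Fin L → ℝ := fun k => -(2 * a (e k))⁻¹ * (G.redIncidence (e k) ⬝ᵥ x) with hr
  set v : Fin (L + n) → (Fin (L + n) → ℝ) × (Fin n → ℝ) :=
    Fin.append (fun i => (Pi.single (e i) 1, 0)) (fun j => (0, Pi.single j 1)) with hv
  -- Column `i` carries the scalar `exp(-s_i²)/√a_i`. The row of a direction `da_{e k}` is `r k`
  -- times a coordinate vector, and the `dx` rows form `𝕀ᵀ`.
  have hdet : G.alphaIntegrand a x (fun k => Pi.single (e k) 1)
      = (Matrix.of fun j i => (Real.exp (-(s i) ^ 2) * (√(a i))⁻¹) *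
          (Matrix.of fun j i => (Fin.addCases r (fun _ => 1) j : ℝ) *
            unitRowsOver e G.redIncidence.transpose j i) j i).det := by
    change Matrix.det (Matrix.of fun j i =>
      (Real.exp (-(s i) ^ 2) • fderiv ℝ (G.edgeVar i) (a, x)) (v j)) = _
    congr 1
    ext j i
    simp only [Matrix.of_apply, smul_apply, smul_eq_mul, mul_assoc]
    congr 1
    induction j using Fin.addCases with
    | left k =>
      simp only [hv, Fin.append_left, fderiv_edgeVar G i (ha i), Matrix.mulVec_zero, Pi.zero_apply,
        unitRowsOver, Matrix.of_apply, Fin.addCases_left, hr, Pi.single_apply]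
      congr 1
      split_ifs with h
      · subst h
        simp only [Matrix.mulVec]
        ring
      · ring
    | right j =>
      simp only [hv, Fin.append_right, fderiv_edgeVar G i (ha i), Matrix.mulVec_single_one,
        unitRowsOver, Matrix.of_apply, Fin.addCases_right, Pi.zero_apply, mul_zero, sub_zero,
        one_mul, Matrix.transpose_apply, Matrix.col_apply]
  have hexp : ∏ i, Real.exp (-(s i) ^ 2)
      = Real.exp (-(x ⬝ᵥ (weightedLaplacian G.redIncidence a).mulVec x)) := by
    rw [← Real.exp_sum, Finset.sum_neg_distrib, dotProduct_weightedLaplacian]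
    congr 2
    refine Finset.sum_congr rfl fun i _ => ?_
    rw [redIncidence_mulVec, hs]
    simp only [edgeVar]
    rw [div_pow, Real.sq_sqrt (ha i).le]
  have hprod : ∏ j : Fin (L + n), (Fin.addCases r (fun _ => 1) j : ℝ)
      = (∏ k, (-(2 * a (e k))⁻¹)) * ∏ k, G.redIncidence (e k) ⬝ᵥ x := by
    rw [Fin.prod_univ_add, ← Finset.prod_mul_distrib]
    simp only [Fin.addCases_left, Fin.addCases_right, Finset.prod_const_one, mul_one, hr]
  rw [hdet, Matrix.det_mul_row, Matrix.det_mul_column, Finset.prod_mul_distrib, hexp, hprod]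
  ring

end FeynmanGraph

/-! ### Gaussian moments of the graph. -/

namespace FeynmanGraph

variable {n L : ℕ}

theorem integrable_alphaIntegrand (G : FeynmanGraph n (L + n)) {p : ℕ} (h : L = 2 * p)
    {a : Fin (L + n) → ℝ} (ha : ∀ e, 0 < a e)
    (hΛ : (weightedLaplacian G.redIncidence a).PosDef) : Integrable (G.alphaIntegrand a) := by
  obtain ⟨R, hR, hR0, -⟩ := exists_transpose_mul_self_of_posDef hΛ
  refine integrable_form fun e => ?_
  simp only [alphaIntegrand_apply_single G ha]
  refine Integrable.const_mul ?_ _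
  have hint := (integral_gaussian_wick h R hR0 fun k => G.redIncidence (e k)).1
  simpa only [← hR, ← Matrix.mulVec_mulVec, Matrix.dotProduct_mulVec, Matrix.vecMul_transpose]
    using hint

/-- The moments of the Gaussian attached to the graph, in terms of Dodgson polynomials. -/
theorem integral_prod_redIncidence (G : FeynmanGraph n (L + n)) {p : ℕ} (h : L = 2 * p)
    {a : Fin (L + n) → ℝ} (ha : ∀ e, 0 < a e)
    (hΛ : (weightedLaplacian G.redIncidence a).PosDef) {e : Fin L → Fin (L + n)}
    (he : Function.Injective e) :
    (2 ^ p * p.factorial : ℝ) * ∫ x : Fin n → ℝ, (∏ k, G.redIncidence (e k) ⬝ᵥ x)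
        * Real.exp (-(x ⬝ᵥ (weightedLaplacian G.redIncidence a).mulVec x))
      = (√(weightedLaplacian G.redIncidence a).det)⁻¹ * Real.pi ^ ((n : ℝ) / 2)
        * ((-(2 * G.symanzik a)⁻¹) ^ p * (∏ k, (-1) ^ (e k).val * a (e k))
          * ∑ σ : Equiv.Perm (Fin L), ∏ k : Fin p, G.edgeDodgson a
              (e (σ ⟨2 * k, by omega⟩)) (e (σ ⟨2 * k + 1, by omega⟩))) := by
  obtain ⟨R, hR, hR0, hRd⟩ := exists_transpose_mul_self_of_posDef hΛ
  have hdet : (weightedLaplacian G.redIncidence a).det ≠ 0 := hΛ.det_pos.ne'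
  have hψ : G.symanzik a ≠ 0 := by
    rw [G.symanzik_eq ha]
    exact mul_ne_zero (Finset.prod_pos fun e _ => ha e).ne' hdet
  have hwick := (integral_gaussian_wick h R hR0 fun k => G.redIncidence (e k)).2
  rw [hRd] at hwick
  simp only [Matrix.dotProduct_mulVec _ R, ← Matrix.mulVec_transpose R, Matrix.mulVec_mulVec] at hwick
  simp only [hR] at hwick
  simp only [dotProduct_comm ((weightedLaplacian G.redIncidence a).mulVec _)] at hwick
  rw [hwick]
  congr 1
  rw [Finset.mul_sum]
  refine Finset.sum_congr rfl fun σ _ => ?_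
  have hcov : ∀ i j : Fin L, i ≠ j → (G.redIncidence (e i) ⬝ᵥ
      ((weightedLaplacian G.redIncidence a)⁻¹).mulVec (G.redIncidence (e j))) / 2
      = -(2 * G.symanzik a)⁻¹ * (((-1) ^ (e i).val * a (e i)) * ((-1) ^ (e j).val * a (e j)))
        * G.edgeDodgson a (e i) (e j) := by
    intro i j hij
    have hsymm : (weightedLaplacian G.redIncidence a)⁻¹.transpose
        = (weightedLaplacian G.redIncidence a)⁻¹ := by
      rw [Matrix.transpose_nonsing_inv, ← Matrix.conjTranspose_eq_transpose_of_trivial,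
        hΛ.isHermitian.eq]
    have hentry : (G.redIncidence * (weightedLaplacian G.redIncidence a)⁻¹
        * G.redIncidence.transpose) (e j) (e i) = G.redIncidence (e i) ⬝ᵥ
      ((weightedLaplacian G.redIncidence a)⁻¹).mulVec (G.redIncidence (e j)) := by
      rw [dotProduct_comm, ← hsymm, Matrix.mulVec_transpose, hsymm]
      rfl
    rw [G.edgeDodgson_eq ha hdet (he.ne hij), hentry]
    have h1 := (ha (e i)).ne'
    have h2 := (ha (e j)).ne'
    have h3 : ((-1 : ℝ) ^ (e i).val) ^ 2 = 1 := by
      rw [← pow_mul, mul_comm, pow_mul, neg_one_sq, one_pow]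
    have h4 : ((-1 : ℝ) ^ (e j).val) ^ 2 = 1 := by
      rw [← pow_mul, mul_comm, pow_mul, neg_one_sq, one_pow]
    rw [pow_add]
    field_simp
    rw [h3, h4]
    ring
  -- Every index occurs in exactly one pair, so the weights `(-1)^e a_e` multiply to a product
  -- independent of `σ`.
  rw [← Equiv.prod_comp σ (fun k => (-1 : ℝ) ^ (e k).val * a (e k)), ← prod_pairs h]
  rw [← Fin.prod_const p, ← Finset.prod_mul_distrib, ← Finset.prod_mul_distrib]
  refine Finset.prod_congr rfl fun k _ => ?_
  exact hcov _ _ (fun hk => by simpa using σ.injective hk)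

end FeynmanGraph

end

/-! ### Assembly of signs, powers of two and powers of `ψ`. -/

theorem mainTheorem2 (n L : ℕ) (hL : Even L) (G : FeynmanGraph n (L + n))
    (T : Finset (Fin (L + n))) (hT : G.IsSpanningTree T)
    (a : Fin (L + n) → ℝ) (ha : ∀ e, 0 < a e) :
    Integrable (G.alphaIntegrand a) ∧ 0 < G.symanzik a ∧
    formCoeff Tᶜ hT.card_compl (G.alpha a) =
      Real.pi ^ ((n : ℝ) / 2)
          / (4 ^ L * ((L / 2).factorial : ℝ) * G.symanzik a ^ (((L : ℝ) + 1) / 2))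
        * (G.redIncidenceRows T hT.card_eq).det
        * ∑ σ : Equiv.Perm (Fin L), ∏ k : Fin (L / 2),
            G.edgeDodgson a
              (Tᶜ.orderEmbOfFin hT.card_compl (σ ⟨2 * k, by omega⟩))
              (Tᶜ.orderEmbOfFin hT.card_compl (σ ⟨2 * k + 1, by omega⟩)) := by
  have h : L = 2 * (L / 2) := (Nat.two_mul_div_two_of_even hL).symm
  have hΛ := weightedLaplacian_posDef G.redIncidence ha hT.eq_zero_of_mulVec_eq_zero
  have hint := G.integrable_alphaIntegrand h ha hΛ
  have hprod : 0 < ∏ e, a e := Finset.prod_pos fun e _ => ha e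
  have hψ : 0 < G.symanzik a := by
    rw [G.symanzik_eq ha]
    exact mul_pos hprod hΛ.det_pos
  refine ⟨hint, hψ, ?_⟩
  set e := Tᶜ.orderEmbOfFin hT.card_compl with he
  have hmoment := G.integral_prod_redIncidence h ha hΛ e.injective
  set W := ∑ σ : Equiv.Perm (Fin L), ∏ k : Fin (L / 2),
    G.edgeDodgson a (e (σ ⟨2 * k, by omega⟩)) (e (σ ⟨2 * k + 1, by omega⟩)) with hW
  have hval : formCoeff Tᶜ hT.card_compl (G.alpha a)
      = ((∏ i, (√(a i))⁻¹) * (∏ k, (-(2 * a (e k))⁻¹))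
          * (unitRowsOver e G.redIncidence.transpose).det)
        * ∫ x : Fin n → ℝ, (∏ k, G.redIncidence (e k) ⬝ᵥ x)
          * Real.exp (-(x ⬝ᵥ (weightedLaplacian G.redIncidence a).mulVec x)) := by
    rw [← integral_const_mul, formCoeff, FeynmanGraph.alpha, integral_form_apply hint]
    simp only [G.alphaIntegrand_apply_single ha]
    rfl
  have hrows : (G.redIncidence.transpose.submatrix id (T.orderEmbOfFin hT.card_eq)).det
      = (G.redIncidenceRows T hT.card_eq).det := by
    rw [← Matrix.det_transpose]
    rfl
  -- The product of the `(-1)^{e k}` occurs again in `hmoment`, so only its square survives.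
  have hsign : (-1 : ℝ) ^ (∑ k : Fin L, ((e k).val + k.val))
      = (∏ k, (-1) ^ (e k).val) * (-1) ^ (L / 2) := by
    rw [Finset.sum_add_distrib, pow_add, sum_fin_val_parity h, Finset.prod_pow_eq_pow_sum]
  have hsign2 : (∏ k, (-1 : ℝ) ^ (e k).val) ^ 2 = 1 := by
    rw [Finset.prod_pow_eq_pow_sum, ← pow_mul, mul_comm, pow_mul, neg_one_sq, one_pow]
  have hsqrt : (∏ i, (√(a i))⁻¹) * (√(weightedLaplacian G.redIncidence a).det)⁻¹
      = (√(G.symanzik a))⁻¹ := by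
    rw [G.symanzik_eq ha, Real.sqrt_mul hprod.le, mul_inv, Finset.prod_inv_distrib,
      Real.sqrt_prod _ fun i _ => (ha i).le]
  have hpow : G.symanzik a ^ (((L : ℝ) + 1) / 2) = G.symanzik a ^ (L / 2) * √(G.symanzik a) := by
    have : ((L : ℝ) + 1) / 2 = ((L / 2 : ℕ) : ℝ) + 1 / 2 := by
      nth_rewrite 1 [h]
      push_cast
      ring
    rw [this, Real.rpow_add hψ, Real.rpow_natCast, Real.sqrt_eq_rpow]
  have ha' : (∏ k, (-(2 * a (e k))⁻¹)) * ∏ k, a (e k) = (4 ^ (L / 2))⁻¹ := by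
    rw [← Finset.prod_mul_distrib]
    have : ∀ k, -(2 * a (e k))⁻¹ * a (e k) = -(2 : ℝ)⁻¹ := fun k => by
      have := (ha (e k)).ne'
      field_simp
    simp only [this, Finset.prod_const, Finset.card_univ, Fintype.card_fin]
    nth_rewrite 1 [h]
    rw [pow_mul, ← inv_pow]
    norm_num
  have h4 : (4 : ℝ) ^ L = 4 ^ (L / 2) * (2 ^ (L / 2) * 2 ^ (L / 2)) := by
    nth_rewrite 1 [h]
    rw [two_mul, pow_add, ← mul_pow (2 : ℝ)]
    norm_num
  have hfac : (2 ^ (L / 2) * (L / 2).factorial : ℝ) ≠ 0 := by positivity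
  rw [hval, det_unitRowsOver _ T hT.card_eq hT.card_compl, hrows, ← he, hsign, hpow, h4]
  rw [Finset.prod_mul_distrib] at hmoment
  have hI := (eq_div_iff hfac).2 ((mul_comm _ _).trans hmoment)
  -- The minus signs of the `L/2` covariances cancel the remaining part of the shuffle sign.
  have hneg : (-(2 * G.symanzik a)⁻¹) ^ (L / 2) * (-1) ^ (L / 2)
      = (2 ^ (L / 2) * G.symanzik a ^ (L / 2))⁻¹ := by
    rw [← mul_pow, ← mul_pow, ← inv_pow]
    ring
  calc _ = ((∏ i, (√(a i))⁻¹) * (√(weightedLaplacian G.redIncidence a).det)⁻¹)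
        * ((∏ k, (-(2 * a (e k))⁻¹)) * ∏ k, a (e k)) * (∏ k, (-1 : ℝ) ^ (e k).val) ^ 2
        * ((-(2 * G.symanzik a)⁻¹) ^ (L / 2) * (-1) ^ (L / 2))
        * Real.pi ^ ((n : ℝ) / 2) * (G.redIncidenceRows T hT.card_eq).det * W
        / (2 ^ (L / 2) * (L / 2).factorial) := by
        rw [hI]
        ring
    _ = _ := by
        rw [hsqrt, ha', hsign2, hneg]
        field_simp
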